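/- Let $k$ be a field and let $m\ge 2$ be an integer. Put $n_1=m(m+1)$, $n_2=m(m+1)+1$, $n_3=(m+1)^2$, $n_4=(m+1)^2+1$, and let $\mathfrak S_m=\langle n_1,n_2,n_3,n_4\rangle\subseteq\mathbb N$ be the Arslan semigroup. Let $R=k[[t^{n_1},t^{n_2},t^{n_3},t^{n_4}]]$, with maximal ideal $\mathfrak m$, and let $G_{\mathfrak m}(\mathfrak S_m)=\bigoplus_{n\ge 0}\mathfrak m^n/\mathfrak m^{n+1}$ be its tangent cone. Then every $\mathfrak m^n/\mathfrak m^{n+1}$ is finite-dimensional over $k$, and the Hilbert series of the tangent cone is $$\sum_{n\ge 0}\dim_k\left(\mathfrak m^n/\mathfrak m^{n+1}\right)x^n=\frac{1+\sum_{j=1}^{m-1}(2j+1)x^j+m\,x^m}{1-x}.$$ Moreover, the coefficients of the numerator count the elements of the Apéry set $\mathrm{Ap}(\mathfrak S_m,n_1)=\{s\in\mathfrak S_m : s-n_1\notin\mathfrak S_m\}$ by their order, where $\mathrm{ord}(s)$ is the largest value of $s_1+s_2+s_3+s_4$ over all $s_1,\dots,s_4\in\mathbb N$ with $s=s_1n_1+s_2n_2+s_3n_3+s_4n_4$: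 the Apéry set has exactly $2j+1$ elements of order $j$ for each $0\le j\le m-1$, exactly $m$ elements of order $m$, and no element of order greater than $m$. -/

import Mathlib

noncomputable section

open PowerSeries

/-- The submonoid of `(ℕ, +)` generated by `a 0, …, a (e - 1)`. -/
def semigroupOf {e : ℕ} (a : Fin e → ℕ) : AddSubmonoid ℕ :=
  AddSubmonoid.closure (Set.range a)

/-- The generators `n₁, n₂, n₃, n₄` of the Arslan semigroup `𝔖_m`. -/
def arslanGen (m : ℕ) : Fin 4 → ℕ :=
  ![m * (m + 1), m * (m + 1) + 1, (m + 1) ^ 2, (m + 1) ^ 2 + 1]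

/-- The Apéry set `Ap(Γ, a) = {s ∈ Γ | s - a ∉ Γ}` (the subtraction is that of `ℤ`). -/
def aperySet (Γ : AddSubmonoid ℕ) (a : ℕ) : Set ℕ :=
  {s | s ∈ Γ ∧ ¬ ∃ u ∈ Γ, (u : ℤ) = (s : ℤ) - (a : ℤ)}

/-- The order of `x` with respect to the generators `a`: the largest total order `∑ i, s i` of a
factorization `x = ∑ i, s i * a i`.  (For positive generators the set of total orders is bounded,
and it is nonempty exactly when `x` lies in the semigroup.) -/
def factorizationOrder {e : ℕ} (a : Fin e → ℕ) (x : ℕ) : ℕ :=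
  sSup {l | ∃ s : Fin e → ℕ, ∑ i, s i * a i = x ∧ ∑ i, s i = l}

/-- The ring `k[[Γ]] = k[[t^{a₁}, …, t^{aₑ}]]` of the semigroup `Γ` generated by `a₁, …, aₑ`: the
power series in `t` all of whose exponents lie in `Γ`. -/
def semigroupPowerSeries (k : Type*) [Field k] (Γ : AddSubmonoid ℕ) : Subalgebra k k⟦X⟧ where
  carrier := {f | ∀ n, coeff n f ≠ 0 → n ∈ Γ}
  mul_mem' := by
    intro f g hf hg n hn
    rw [coeff_mul] at hn
    obtain ⟨p, hp, hpn⟩ := Finset.exists_ne_zero_of_sum_ne_zero hn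
    rw [← Finset.HasAntidiagonal.mem_antidiagonal.mp hp]
    exact Γ.add_mem (hf _ (left_ne_zero_of_mul hpn)) (hg _ (right_ne_zero_of_mul hpn))
  add_mem' := by
    intro f g hf hg n hn
    by_contra h
    have h1 : coeff n f = 0 := by_contra fun h' => h (hf n h')
    have h2 : coeff n g = 0 := by_contra fun h' => h (hg n h')
    exact hn (by rw [map_add, h1, h2, add_zero])
  algebraMap_mem' := by
    intro c n hn
    have h0 : n = 0 := by
      by_contra h
      exact hn (by simp [coeff_C, h])
    rw [h0]
    exact Γ.zero_mem

theorem semigroupPowerSeries_inv_mem {k : Type*} [Field k] {Γ : AddSubmonoid ℕ} {f : k⟦X⟧}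
    (hf : f ∈ semigroupPowerSeries k Γ) : f⁻¹ ∈ semigroupPowerSeries k Γ := by
  intro n
  induction n using Nat.strong_induction_on with
  | _ n ih =>
    intro hn
    rw [coeff_inv] at hn
    split_ifs at hn with h0
    · rw [h0]
      exact Γ.zero_mem
    · obtain ⟨p, hp, hpn⟩ := Finset.exists_ne_zero_of_sum_ne_zero (right_ne_zero_of_mul hn)
      split_ifs at hpn with hlt
      · rw [← Finset.HasAntidiagonal.mem_antidiagonal.mp hp]
        exact Γ.add_mem (hf _ (left_ne_zero_of_mul hpn)) (ih _ hlt (right_ne_zero_of_mul hpn))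
      · exact absurd rfl hpn

theorem semigroupPowerSeries_isUnit {k : Type*} [Field k] {Γ : AddSubmonoid ℕ}
    (f : semigroupPowerSeries k Γ) (h : constantCoeff (f : k⟦X⟧) ≠ 0) : IsUnit f :=
  IsUnit.of_mul_eq_one ⟨(f : k⟦X⟧)⁻¹, semigroupPowerSeries_inv_mem f.2⟩
    (Subtype.ext (PowerSeries.mul_inv_cancel (f : k⟦X⟧) h))

instance semigroupPowerSeries_isLocalRing (k : Type*) [Field k] (Γ : AddSubmonoid ℕ) :
    IsLocalRing (semigroupPowerSeries k Γ) := by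
  refine IsLocalRing.of_isUnit_or_isUnit_one_sub_self fun f => ?_
  by_cases h : constantCoeff (f : k⟦X⟧) = 0
  · right
    exact semigroupPowerSeries_isUnit _ (by simp [h])
  · left
    exact semigroupPowerSeries_isUnit _ h

/-- The component `𝔪ⁿ / 𝔪ⁿ⁺¹` of degree `n` of the tangent cone `G_𝔪(R) = ⨁ₙ 𝔪ⁿ / 𝔪ⁿ⁺¹` of a local
ring `R` with maximal ideal `𝔪`. -/
abbrev TangentConeComponent (R : Type*) [CommRing R] [IsLocalRing R] (n : ℕ) : Type _ :=
  ↥(IsLocalRing.maximalIdeal R ^ n) ⧸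
    (IsLocalRing.maximalIdeal R ^ (n + 1)).submoduleOf (IsLocalRing.maximalIdeal R ^ n)

/-- The Hilbert series `∑ₙ dim_k (𝔪ⁿ / 𝔪ⁿ⁺¹) xⁿ` of the tangent cone of a local `k`-algebra `R`. -/
def tangentConeHilbertSeries (k : Type*) [Field k] (R : Type*) [CommRing R] [IsLocalRing R]
    [Algebra k R] : ℤ⟦X⟧ :=
  PowerSeries.mk fun n => (Module.finrank k (TangentConeComponent R n) : ℤ)

end

/-! ### Factorization lengths in a numerical semigroup. -/

section Semigroup

/-! In `k[[Γ]]`, the power `𝔪ⁿ` consists of the series whose exponents all have a factorization of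
length at least `n`, so `dim 𝔪ⁿ/𝔪ⁿ⁺¹` counts the elements of order `n`
(`tangentConeComponent_equiv`).

The Arslan generators are `n₁ + ε + (m+1)δ` with `ε, δ ∈ {0, 1}`, so the sums of `l` of them are the
numbers `l n₁ + p + (m+1)q` with `p, q ≤ l`. It follows that the order of `s` is `s / n₁`, and that
there are `(n+1)²` elements of order `n` if `n < m` and `n₁ = m(m+1)` if `n ≥ m`.

Multiplication by `1 - x` takes successive differences: `2j+1`, then `m(m+1) - m² = m`, then `0`.
Adding `n₁` raises the order by exactly one, so the same differences count Apéry elements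
(`apery_order_succ_ncard`). -/

theorem mem_semigroupOf_iff {e : ℕ} (a : Fin e → ℕ) (s : ℕ) :
    s ∈ semigroupOf a ↔ ∃ x : Fin e → ℕ, ∑ i, x i * a i = s := by
  constructor
  · intro h
    induction h using AddSubmonoid.closure_induction with
    | mem y hy =>
      obtain ⟨i, rfl⟩ := hy
      exact ⟨Pi.single i 1, by simp [Pi.single_apply]⟩
    | zero => exact ⟨0, by simp⟩
    | add y z _ _ hy hz =>
      obtain ⟨x, rfl⟩ := hy
      obtain ⟨x', rfl⟩ := hz
      exact ⟨x + x', by simp only [Pi.add_apply, add_mul, Finset.sum_add_distrib]⟩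
  · rintro ⟨x, rfl⟩
    refine AddSubmonoid.sum_mem _ fun i _ => ?_
    rw [← smul_eq_mul]
    exact AddSubmonoid.nsmul_mem _ (AddSubmonoid.subset_closure (Set.mem_range_self i)) _

/-- The natural numbers with a factorization of length at least `n` with respect to `a`. -/
def longFactorizations {e : ℕ} (a : Fin e → ℕ) (n : ℕ) : Set ℕ :=
  {s | ∃ x : Fin e → ℕ, ∑ i, x i * a i = s ∧ n ≤ ∑ i, x i}

theorem longFactorizations_subset {e : ℕ} (a : Fin e → ℕ) {n s : ℕ}
    (h : s ∈ longFactorizations a n) : s ∈ semigroupOf a :=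
  (mem_semigroupOf_iff a s).2 (h.imp fun _ hx => hx.1)

theorem add_mem_longFactorizations {e : ℕ} {a : Fin e → ℕ} {n n' s s' : ℕ}
    (h : s ∈ longFactorizations a n) (h' : s' ∈ longFactorizations a n') :
    s + s' ∈ longFactorizations a (n + n') := by
  obtain ⟨x, rfl, hx⟩ := h
  obtain ⟨x', rfl, hx'⟩ := h'
  refine ⟨x + x', by simp [add_mul, Finset.sum_add_distrib], ?_⟩
  simp only [Pi.add_apply, Finset.sum_add_distrib]
  omega

theorem mem_longFactorizations_one {e : ℕ} {a : Fin e → ℕ} {s : ℕ}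
    (h : s ∈ semigroupOf a) (hs : s ≠ 0) : s ∈ longFactorizations a 1 := by
  obtain ⟨x, rfl⟩ := (mem_semigroupOf_iff a s).1 h
  refine ⟨x, rfl, Nat.one_le_iff_ne_zero.2 fun h0 => hs ?_⟩
  have h1 : ∀ i, x i = 0 := by simpa using h0
  simp [h1]

theorem exists_add_of_mem_longFactorizations_succ {e : ℕ} {a : Fin e → ℕ} {n s : ℕ}
    (h : s ∈ longFactorizations a (n + 1)) :
    ∃ i, ∃ u ∈ longFactorizations a n, u + a i = s := by
  obtain ⟨x, rfl, hx⟩ := h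
  obtain ⟨i, -, hi⟩ : ∃ i ∈ Finset.univ, x i ≠ 0 :=
    Finset.exists_ne_zero_of_sum_ne_zero (by omega)
  have hxi : x = Function.update x i (x i - 1) + Pi.single i 1 := by
    ext j
    by_cases hj : j = i
    · subst hj
      simp
      omega
    · simp [hj]
  set y := Function.update x i (x i - 1)
  refine ⟨i, ∑ j, y j * a j, ⟨y, rfl, ?_⟩, ?_⟩
  · have h2 : ∑ j, x j = ∑ j, y j + 1 := by
      rw [hxi]
      simp [Finset.sum_add_distrib]
    omega
  · conv_rhs => rw [hxi]
    simp [Finset.sum_add_distrib, add_mul, Pi.single_apply]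

end Semigroup

/-! ### Powers of the maximal ideal, described by exponents. -/

section MaximalIdeal

open PowerSeries

variable {k : Type*} [Field k]

theorem mem_maximalIdeal_semigroupPowerSeries_iff {Γ : AddSubmonoid ℕ}
    (f : semigroupPowerSeries k Γ) :
    f ∈ IsLocalRing.maximalIdeal (semigroupPowerSeries k Γ) ↔
      constantCoeff (f : k⟦X⟧) = 0 := by
  rw [IsLocalRing.mem_maximalIdeal, mem_nonunits_iff]
  constructor
  · intro h
    by_contra h0
    exact h (semigroupPowerSeries_isUnit f h0)
  · intro h hu
    have h1 := (hu.map (semigroupPowerSeries k Γ).val).map (constantCoeff (R := k))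
    exact h1.ne_zero h

/-- The monomial `tˢ` of the ring `k[[Γ]]`, for `s ∈ Γ`. -/
noncomputable def semigroupMonomial (k : Type*) [Field k] {Γ : AddSubmonoid ℕ} {s : ℕ} (hs : s ∈ Γ) :
    semigroupPowerSeries k Γ :=
  ⟨X ^ s, fun n hn => by
    rw [coeff_X_pow] at hn
    have h : n = s := by
      by_contra h
      exact hn (if_neg h)
    exact h ▸ hs⟩

theorem coeff_mem_of_mem_maximalIdeal_pow {e : ℕ} {a : Fin e → ℕ} {n : ℕ}
    {f : semigroupPowerSeries k (semigroupOf a)}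
    (hf : f ∈ IsLocalRing.maximalIdeal (semigroupPowerSeries k (semigroupOf a)) ^ n)
    {s : ℕ} (hs : coeff s (f : k⟦X⟧) ≠ 0) : s ∈ longFactorizations a n := by
  induction n generalizing f s with
  | zero =>
    obtain ⟨x, hx⟩ := (mem_semigroupOf_iff a s).1 (f.2 s hs)
    exact ⟨x, hx, Nat.zero_le _⟩
  | succ n ih =>
    rw [pow_succ] at hf
    induction hf using Submodule.mul_induction_on' generalizing s with
    | mem_mul_mem g hg h hh =>
      rw [MulMemClass.coe_mul, coeff_mul] at hs
      obtain ⟨p, hp, hpn⟩ := Finset.exists_ne_zero_of_sum_ne_zero hs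
      rw [← Finset.HasAntidiagonal.mem_antidiagonal.mp hp]
      have hp2 := right_ne_zero_of_mul hpn
      refine add_mem_longFactorizations (ih hg (left_ne_zero_of_mul hpn))
        (mem_longFactorizations_one (h.2 _ hp2) fun h0 => hp2 ?_)
      rw [h0, coeff_zero_eq_constantCoeff_apply]
      exact (mem_maximalIdeal_semigroupPowerSeries_iff h).1 hh
    | add g _ h _ hg hh =>
      by_cases h0 : coeff s (g : k⟦X⟧) = 0
      · refine hh fun h1 => hs ?_
        simp [h0, h1]
      · exact hg h0

/-- Each exponent of `f` is assigned one generator that can be split off. Grouping by generator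
writes `f` as a finite sum of `q i * t^(a i)`, even for infinite support, and induction applies to
each `q i`. -/
theorem mem_maximalIdeal_pow_of_coeff_mem {e : ℕ} {a : Fin e → ℕ} (ha : ∀ i, 0 < a i) {n : ℕ}
    {f : semigroupPowerSeries k (semigroupOf a)}
    (hf : ∀ s, coeff s (f : k⟦X⟧) ≠ 0 → s ∈ longFactorizations a n) :
    f ∈ IsLocalRing.maximalIdeal (semigroupPowerSeries k (semigroupOf a)) ^ n := by
  classical
  induction n generalizing f with
  | zero => simp
  | succ n ih =>
    -- `none` serves the exponents outside the support: `Fin e` may be empty.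
    have hex : ∀ s, ∃ i : Option (Fin e), coeff s (f : k⟦X⟧) ≠ 0 →
        ∃ j, i = some j ∧ ∃ u ∈ longFactorizations a n, u + a j = s := by
      intro s
      by_cases hs : coeff s (f : k⟦X⟧) = 0
      · exact ⟨none, fun h => absurd hs h⟩
      · obtain ⟨i, hi⟩ := exists_add_of_mem_longFactorizations_succ (hf s hs)
        exact ⟨some i, fun _ => ⟨i, rfl, hi⟩⟩
    choose c hc using hex
    let p : Fin e → k⟦X⟧ := fun i =>
      PowerSeries.mk fun u => if c (u + a i) = some i then coeff (u + a i) (f : k⟦X⟧) else 0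
    have hp : ∀ i u, coeff u (p i) ≠ 0 → u ∈ longFactorizations a n := by
      intro i u hu
      rw [coeff_mk] at hu
      obtain ⟨h1, h2⟩ := ite_ne_right_iff.1 hu
      obtain ⟨j, hj, v, hv, hvu⟩ := hc _ h2
      obtain rfl : i = j := Option.some_injective _ (h1.symm.trans hj)
      obtain rfl : v = u := by omega
      exact hv
    let q : Fin e → semigroupPowerSeries k (semigroupOf a) := fun i =>
      ⟨p i, fun u hu => longFactorizations_subset a (hp i u hu)⟩
    have hai : ∀ i, a i ∈ semigroupOf a := fun i => AddSubmonoid.subset_closure ⟨i, rfl⟩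
    have hfq : f = ∑ i, q i * semigroupMonomial k (hai i) := by
      refine Subtype.ext (PowerSeries.ext fun s => ?_)
      rw [AddSubmonoidClass.coe_finsetSum, map_sum]
      have hterm : ∀ i, coeff s ((q i * semigroupMonomial k (hai i) :
          semigroupPowerSeries k (semigroupOf a)) : k⟦X⟧) =
          if c s = some i then coeff s (f : k⟦X⟧) else 0 := by
        intro i
        change coeff s (p i * X ^ a i) = _
        rw [coeff_mul_X_pow']
        split_ifs with h1 h2 h2
        · rw [coeff_mk, Nat.sub_add_cancel h1, if_pos h2]
        · rw [coeff_mk, Nat.sub_add_cancel h1, if_neg h2]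
        · by_contra h3
          obtain ⟨j, hj, u, -, hu⟩ := hc s (Ne.symm h3)
          obtain rfl : i = j := Option.some_injective _ (h2.symm.trans hj)
          omega
        · rfl
      rw [Finset.sum_congr rfl fun i _ => hterm i]
      by_cases hs : coeff s (f : k⟦X⟧) = 0
      · simp [hs]
      · obtain ⟨j, hj, -⟩ := hc s hs
        simp [hj]
    rw [hfq, pow_succ]
    refine Ideal.sum_mem _ fun i _ => Ideal.mul_mem_mul (ih (hp i)) ?_
    rw [mem_maximalIdeal_semigroupPowerSeries_iff]
    change constantCoeff (X ^ a i : k⟦X⟧) = 0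
    simp [(ha i).ne']

/-- Reading off the coefficients at exponents of order exactly `n` maps `𝔪ⁿ` onto the functions on
these exponents, with kernel `𝔪ⁿ⁺¹`. -/
theorem tangentConeComponent_equiv (k : Type*) [Field k] {e : ℕ} {a : Fin e → ℕ}
    (ha : ∀ i, 0 < a i) (n : ℕ) :
    Nonempty (TangentConeComponent (semigroupPowerSeries k (semigroupOf a)) n ≃ₗ[k]
      (↥(longFactorizations a n \ longFactorizations a (n + 1)) → k)) := by
  classical
  set R := semigroupPowerSeries k (semigroupOf a)
  set I := IsLocalRing.maximalIdeal R
  set B := longFactorizations a n \ longFactorizations a (n + 1)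
  let φ : ↥(I ^ n) →ₗ[k] (B → k) :=
    { toFun := fun f s => coeff (s : ℕ) ((f : R) : k⟦X⟧)
      map_add' := fun f g => by ext s; simp
      map_smul' := fun c f => by ext s; simp }
  have hker : LinearMap.ker φ = ((I ^ (n + 1)).submoduleOf (I ^ n)).restrictScalars k := by
    ext f
    rw [LinearMap.mem_ker, Submodule.restrictScalars_mem]
    change _ ↔ (f : R) ∈ I ^ (n + 1)
    constructor
    · intro h
      refine mem_maximalIdeal_pow_of_coeff_mem ha fun s hs => ?_
      by_contra h1
      exact hs (congrFun h ⟨s, coeff_mem_of_mem_maximalIdeal_pow f.2 hs, h1⟩)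
    · intro h
      ext s
      by_contra h1
      exact s.2.2 (coeff_mem_of_mem_maximalIdeal_pow h h1)
  have hsurj : Function.Surjective φ := by
    intro g
    let G : k⟦X⟧ := PowerSeries.mk fun s => if h : s ∈ B then g ⟨s, h⟩ else 0
    have hG : ∀ s, coeff s G ≠ 0 → s ∈ longFactorizations a n := by
      intro s hs
      rw [coeff_mk] at hs
      by_contra h
      exact hs (dif_neg fun h' => h h'.1)
    refine ⟨⟨⟨G, fun s hs => longFactorizations_subset a (hG s hs)⟩,
      mem_maximalIdeal_pow_of_coeff_mem ha hG⟩, ?_⟩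
    ext s
    change coeff (s : ℕ) G = g s
    rw [coeff_mk, dif_pos s.2]
  exact ⟨(Submodule.Quotient.restrictScalarsEquiv k _).symm.trans
    ((Submodule.quotEquivOfEq _ _ hker.symm).trans (φ.quotKerEquivOfSurjective hsurj))⟩

end MaximalIdeal

/-! ### Orders and layers of the Arslan semigroup. -/

section Arslan

open PowerSeries

theorem arslanGen_pos {m : ℕ} (hm : 0 < m) (i : Fin 4) : 0 < arslanGen m i := by
  fin_cases i <;> simp [arslanGen, hm]

/-- Factorizations of length `l` in the Arslan semigroup, in coordinates. -/
theorem exists_factorization_arslanGen_iff (m s l : ℕ) :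
    (∃ x : Fin 4 → ℕ, ∑ i, x i * arslanGen m i = s ∧ ∑ i, x i = l) ↔
      ∃ p ≤ l, ∃ q ≤ l, s = l * (m * (m + 1)) + (p + (m + 1) * q) := by
  constructor
  · rintro ⟨x, rfl, rfl⟩
    simp only [Fin.sum_univ_four, arslanGen, Matrix.cons_val]
    exact ⟨x 1 + x 3, by omega, x 2 + x 3, by omega, by ring⟩
  · rintro ⟨p, hp, q, hq, rfl⟩
    -- Take `min p q` copies of `n₄`, the excess as `n₃` or `n₂`, and fill up to length `l` with
    -- `n₁`.
    rcases le_total p q with h | h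
    · obtain ⟨d, rfl⟩ := Nat.exists_eq_add_of_le h
      obtain ⟨c, rfl⟩ := Nat.exists_eq_add_of_le hq
      refine ⟨![c, 0, d, p], ?_, ?_⟩ <;>
        simp only [Fin.sum_univ_four, arslanGen, Matrix.cons_val] <;> ring
    · obtain ⟨d, rfl⟩ := Nat.exists_eq_add_of_le h
      obtain ⟨c, rfl⟩ := Nat.exists_eq_add_of_le hp
      refine ⟨![c, d, 0, q], ?_, ?_⟩ <;>
        simp only [Fin.sum_univ_four, arslanGen, Matrix.cons_val] <;> ring

/-- The left side is at most `(m-1)(m+2) = m(m+1) - 2`. -/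
theorem add_mul_lt_of_le {m l p q : ℕ} (hl : l < m) (hp : p ≤ l) (hq : q ≤ l) :
    p + (m + 1) * q < m * (m + 1) := by
  obtain ⟨c, rfl⟩ := Nat.exists_eq_add_of_lt hl
  nlinarith [Nat.mul_le_mul_left (l + c + 1 + 1) hq]

theorem exists_factorization_length_div {m s : ℕ} (hm : 0 < m)
    (hs : s ∈ semigroupOf (arslanGen m)) :
    ∃ x : Fin 4 → ℕ, ∑ i, x i * arslanGen m i = s ∧ ∑ i, x i = s / (m * (m + 1)) := by
  have hpos : 0 < m * (m + 1) := by positivity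
  obtain ⟨x, hx⟩ := (mem_semigroupOf_iff _ _).1 hs
  obtain ⟨p, hp, q, hq, h⟩ := (exists_factorization_arslanGen_iff m s _).1 ⟨x, hx, rfl⟩
  set l := ∑ i, x i
  rw [exists_factorization_arslanGen_iff]
  rcases lt_or_ge l m with hl | hl
  · have hdiv : s / (m * (m + 1)) = l := by
      rw [h, mul_comm l, Nat.mul_add_div hpos, Nat.div_eq_of_lt (add_mul_lt_of_le hl hp hq),
        add_zero]
    rw [hdiv]
    exact ⟨p, hp, q, hq, h⟩
  -- The given factorization is dropped. The remainder of `s` modulo `n₁` is `p + (m+1)q` with `p ≤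
  -- m` and `q < m`, and both are at most the quotient, which is at least `m`.
  · have hdiv : m ≤ s / (m * (m + 1)) := by
      rw [Nat.le_div_iff_mul_le hpos]
      exact (Nat.mul_le_mul_right _ hl).trans (h ▸ Nat.le_add_right _ _)
    have h1 : s % (m * (m + 1)) % (m + 1) < m + 1 := Nat.mod_lt _ (by omega)
    have h2 : s % (m * (m + 1)) / (m + 1) < m :=
      Nat.div_lt_of_lt_mul (by rw [mul_comm (m + 1)]; exact Nat.mod_lt _ hpos)
    refine ⟨_, (by omega : s % (m * (m + 1)) % (m + 1) ≤ _), _,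
      (by omega : s % (m * (m + 1)) / (m + 1) ≤ _), ?_⟩
    rw [Nat.mod_add_div, Nat.div_add_mod']

theorem factorization_length_le_div {m s : ℕ} (hm : 0 < m) {x : Fin 4 → ℕ}
    (hx : ∑ i, x i * arslanGen m i = s) : ∑ i, x i ≤ s / (m * (m + 1)) := by
  obtain ⟨p, -, q, -, h⟩ := (exists_factorization_arslanGen_iff m s _).1 ⟨x, hx, rfl⟩
  rw [Nat.le_div_iff_mul_le (by positivity)]
  omega

theorem factorizationOrder_arslanGen {m s : ℕ} (hm : 0 < m)
    (hs : s ∈ semigroupOf (arslanGen m)) :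
    factorizationOrder (arslanGen m) s = s / (m * (m + 1)) := by
  refine IsGreatest.csSup_eq ⟨exists_factorization_length_div hm hs, ?_⟩
  rintro l ⟨x, hx, rfl⟩
  exact factorization_length_le_div hm hx

/-- The elements of order `n` of the Arslan semigroup. -/
def arslanLayer (m n : ℕ) : Set ℕ :=
  {s | s ∈ semigroupOf (arslanGen m) ∧ s / (m * (m + 1)) = n}

theorem longFactorizations_arslanGen {m : ℕ} (hm : 0 < m) (n : ℕ) :
    longFactorizations (arslanGen m) n =
      {s | s ∈ semigroupOf (arslanGen m) ∧ n ≤ s / (m * (m + 1))} := by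
  ext s
  constructor
  · intro h
    refine ⟨longFactorizations_subset _ h, ?_⟩
    obtain ⟨x, hx, hn⟩ := h
    exact hn.trans (factorization_length_le_div hm hx)
  · rintro ⟨hs, hn⟩
    obtain ⟨x, hx, hl⟩ := exists_factorization_length_div hm hs
    exact ⟨x, hx, hl ▸ hn⟩

theorem longFactorizations_diff_arslanGen {m : ℕ} (hm : 0 < m) (n : ℕ) :
    longFactorizations (arslanGen m) n \ longFactorizations (arslanGen m) (n + 1) =
      arslanLayer m n := by
  ext s
  simp only [longFactorizations_arslanGen hm, arslanLayer, Set.mem_sdiff, Set.mem_ofPred_eq]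
  constructor
  · rintro ⟨⟨h1, h2⟩, h3⟩
    exact ⟨h1, by by_contra h; exact h3 ⟨h1, by omega⟩⟩
  · rintro ⟨h1, h2⟩
    exact ⟨⟨h1, h2.ge⟩, fun h => by omega⟩

theorem arslanLayer_finite {m : ℕ} (hm : 0 < m) (n : ℕ) : (arslanLayer m n).Finite := by
  refine (Set.finite_Iio ((n + 1) * (m * (m + 1)))).subset ?_
  rintro s ⟨-, h⟩
  exact (Nat.div_lt_iff_lt_mul (by positivity)).1 (h ▸ Nat.lt_succ_self _)

theorem mem_arslanLayer_iff {m : ℕ} (hm : 0 < m) (n s : ℕ) :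
    s ∈ arslanLayer m n ↔ s / (m * (m + 1)) = n ∧
      ∃ p ≤ n, ∃ q ≤ n, s = n * (m * (m + 1)) + (p + (m + 1) * q) := by
  constructor
  · rintro ⟨h, rfl⟩
    exact ⟨rfl, (exists_factorization_arslanGen_iff _ _ _).1
      (exists_factorization_length_div hm h)⟩
  · rintro ⟨h, h'⟩
    obtain ⟨x, hx, -⟩ := (exists_factorization_arslanGen_iff _ _ _).2 h'
    exact ⟨(mem_semigroupOf_iff _ _).2 ⟨x, hx⟩, h⟩

/-- The pairs `(p, q)` with `p, q ≤ n` give distinct elements, as `p < m + 1` is the remainder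
modulo `m + 1`. -/
theorem arslanLayer_ncard_of_lt {m n : ℕ} (hn : n < m) :
    (arslanLayer m n).ncard = (n + 1) ^ 2 := by
  have hm : 0 < m := by omega
  let F : ℕ × ℕ → ℕ := fun z => n * (m * (m + 1)) + (z.1 + (m + 1) * z.2)
  have himg : arslanLayer m n =
      F '' ↑(Finset.range (n + 1) ×ˢ Finset.range (n + 1)) := by
    ext s
    rw [mem_arslanLayer_iff hm]
    simp only [Set.mem_image, Finset.mem_coe, Finset.mem_product, Finset.mem_range,
      Order.lt_add_one_iff, Prod.exists]
    constructor
    · rintro ⟨-, p, hp, q, hq, rfl⟩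
      exact ⟨p, q, ⟨hp, hq⟩, rfl⟩
    · rintro ⟨p, q, ⟨hp, hq⟩, rfl⟩
      refine ⟨?_, p, hp, q, hq, rfl⟩
      change (n * (m * (m + 1)) + (p + (m + 1) * q)) / _ = n
      rw [mul_comm n, Nat.mul_add_div (by positivity),
        Nat.div_eq_of_lt (add_mul_lt_of_le hn hp hq), add_zero]
  have hinj : Set.InjOn F ↑(Finset.range (n + 1) ×ˢ Finset.range (n + 1)) := by
    rintro ⟨p, q⟩ h ⟨p', q'⟩ h' heq
    simp only [Finset.coe_product, Set.mem_prod, Finset.mem_coe, Finset.mem_range] at h h'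
    have heq' : p + (m + 1) * q = p' + (m + 1) * q' := Nat.add_left_cancel heq
    have hmod := congrArg (· % (m + 1)) heq'
    simp only [Nat.add_mul_mod_self_left] at hmod
    rw [Nat.mod_eq_of_lt (by omega), Nat.mod_eq_of_lt (by omega)] at hmod
    subst hmod
    have hq : q = q' := Nat.eq_of_mul_eq_mul_left (by omega : 0 < m + 1) (by omega)
    rw [hq]
  rw [himg, hinj.ncard_image, Set.ncard_coe_finset, Finset.card_product,
    Finset.card_range, sq]

/-- From order `m` on, the layer is a full interval of `n₁` consecutive integers. -/
theorem arslanLayer_ncard_of_le {m n : ℕ} (hm : 0 < m) (hn : m ≤ n) :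
    (arslanLayer m n).ncard = m * (m + 1) := by
  have hpos : 0 < m * (m + 1) := by positivity
  have heq : arslanLayer m n =
      ↑(Finset.Ico (n * (m * (m + 1))) ((n + 1) * (m * (m + 1)))) := by
    ext s
    rw [Finset.coe_Ico, Set.mem_Ico, mem_arslanLayer_iff hm]
    rw [← Nat.le_div_iff_mul_le hpos, ← Nat.div_lt_iff_lt_mul hpos, Order.lt_add_one_iff,
      ← le_antisymm_iff, eq_comm (a := n)]
    refine ⟨fun h => h.1, fun h => ⟨h, ?_⟩⟩
    have h1 : s % (m * (m + 1)) % (m + 1) < m + 1 := Nat.mod_lt _ (by omega)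
    have h2 : s % (m * (m + 1)) / (m + 1) < m :=
      Nat.div_lt_of_lt_mul (by rw [mul_comm (m + 1)]; exact Nat.mod_lt _ hpos)
    refine ⟨_, (by omega : s % (m * (m + 1)) % (m + 1) ≤ _), _,
      (by omega : s % (m * (m + 1)) / (m + 1) ≤ _), ?_⟩
    rw [Nat.mod_add_div, ← h, Nat.div_add_mod']
  rw [heq, Set.ncard_coe_finset, Nat.card_Ico, ← Nat.sub_mul, Nat.add_sub_cancel_left, one_mul]

/-! ### Apéry elements by order. -/

theorem apery_order_eq {m : ℕ} (hm : 0 < m) (j : ℕ) :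
    {w ∈ aperySet (semigroupOf (arslanGen m)) (m * (m + 1)) |
      factorizationOrder (arslanGen m) w = j} =
      arslanLayer m j \ (· + m * (m + 1)) '' {s | s ∈ semigroupOf (arslanGen m)} := by
  ext s
  constructor
  · rintro ⟨⟨hs, h⟩, hj⟩
    rw [factorizationOrder_arslanGen hm hs] at hj
    refine ⟨⟨hs, hj⟩, ?_⟩
    rintro ⟨u, hu, rfl⟩
    exact h ⟨u, hu, by push_cast; ring⟩
  · rintro ⟨⟨hs, hj⟩, h⟩
    refine ⟨⟨hs, ?_⟩, (factorizationOrder_arslanGen hm hs).trans hj⟩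
    rintro ⟨u, hu, hus⟩
    refine h ⟨u, hu, ?_⟩
    change u + m * (m + 1) = s
    zify
    push_cast at hus
    linarith

theorem apery_order_zero_ncard {m : ℕ} (hm : 0 < m) :
    {w ∈ aperySet (semigroupOf (arslanGen m)) (m * (m + 1)) |
      factorizationOrder (arslanGen m) w = 0}.ncard = 1 := by
  rw [apery_order_eq hm, sdiff_eq_left.2, arslanLayer_ncard_of_lt hm]
  · rfl
  · rw [Set.disjoint_left]
    rintro _ ⟨-, hj⟩ ⟨u, -, rfl⟩
    change (u + m * (m + 1)) / _ = 0 at hj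
    rw [Nat.add_div_right _ (by positivity)] at hj
    exact Nat.succ_ne_zero _ hj

/-- The shift by `n₁` embeds layer `j` in layer `j + 1`. An element of layer `j + 1` fails to be
Apéry exactly when it lies in the image. -/
theorem apery_order_succ_ncard {m : ℕ} (hm : 0 < m) (j : ℕ) :
    {w ∈ aperySet (semigroupOf (arslanGen m)) (m * (m + 1)) |
      factorizationOrder (arslanGen m) w = j + 1}.ncard + (arslanLayer m j).ncard =
      (arslanLayer m (j + 1)).ncard := by
  have hpos : 0 < m * (m + 1) := by positivity
  have hgen : m * (m + 1) ∈ semigroupOf (arslanGen m) := AddSubmonoid.subset_closure ⟨0, rfl⟩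
  have hsub : (· + m * (m + 1)) '' arslanLayer m j ⊆ arslanLayer m (j + 1) := by
    rintro _ ⟨u, ⟨hu, hj⟩, rfl⟩
    exact ⟨add_mem hu hgen, by rw [Nat.add_div_right _ hpos, hj]⟩
  have heq : {w ∈ aperySet (semigroupOf (arslanGen m)) (m * (m + 1)) |
      factorizationOrder (arslanGen m) w = j + 1} =
      arslanLayer m (j + 1) \ (· + m * (m + 1)) '' arslanLayer m j := by
    rw [apery_order_eq hm]
    ext s
    refine and_congr_right fun hs => not_congr ⟨?_, ?_⟩
    · rintro ⟨u, hu, rfl⟩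
      refine ⟨u, ⟨hu, ?_⟩, rfl⟩
      have h := hs.2
      rw [Nat.add_div_right _ hpos] at h
      omega
    · rintro ⟨u, hu, rfl⟩
      exact ⟨u, hu.1, rfl⟩
  rw [heq, ← Set.ncard_image_of_injective (arslanLayer m j) (add_left_injective (m * (m + 1))),
    Set.ncard_sdiff_add_ncard_of_subset hsub (arslanLayer_finite hm _)]

/-- Past order `m`, consecutive layers have the same size, which leaves no room for Apéry elements.
-/
theorem factorizationOrder_le_of_mem_apery {m w : ℕ} (hm : 0 < m)
    (hw : w ∈ aperySet (semigroupOf (arslanGen m)) (m * (m + 1))) :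
    factorizationOrder (arslanGen m) w ≤ m := by
  by_contra! h
  obtain ⟨j, hj⟩ := Nat.exists_eq_add_of_lt h
  have hcard := apery_order_succ_ncard hm (m + j)
  rw [arslanLayer_ncard_of_le hm (by omega), arslanLayer_ncard_of_le hm (by omega)] at hcard
  -- Needed because `ncard` is also `0` on infinite sets.
  have hfin : {w ∈ aperySet (semigroupOf (arslanGen m)) (m * (m + 1)) |
      factorizationOrder (arslanGen m) w = m + j + 1}.Finite := by
    rw [apery_order_eq hm]
    exact (arslanLayer_finite hm _).subset Set.sdiff_subset
  have hempty := (Set.ncard_eq_zero hfin).1 (by omega)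
  exact (hempty ▸ (⟨hw, hj⟩ : w ∈ {w ∈ aperySet (semigroupOf (arslanGen m)) (m * (m + 1)) |
      factorizationOrder (arslanGen m) w = m + j + 1}) : w ∈ (∅ : Set ℕ))

/-! ### The Hilbert series. -/

theorem tangentConeComponent_arslan_finite (k : Type*) [Field k] {m : ℕ} (hm : 0 < m) (n : ℕ) :
    Module.Finite k
      (TangentConeComponent (semigroupPowerSeries k (semigroupOf (arslanGen m))) n) := by
  obtain ⟨E⟩ := tangentConeComponent_equiv k (arslanGen_pos hm) n
  rw [longFactorizations_diff_arslanGen hm] at E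
  have := (arslanLayer_finite hm n).to_subtype
  exact Module.Finite.equiv E.symm

theorem tangentConeComponent_arslan_finrank (k : Type*) [Field k] {m : ℕ} (hm : 0 < m) (n : ℕ) :
    Module.finrank k
      (TangentConeComponent (semigroupPowerSeries k (semigroupOf (arslanGen m))) n) =
      (arslanLayer m n).ncard := by
  obtain ⟨E⟩ := tangentConeComponent_equiv k (arslanGen_pos hm) n
  rw [longFactorizations_diff_arslanGen hm] at E
  have := (arslanLayer_finite hm n).fintype
  rw [E.finrank_eq, Module.finrank_fintype_fun_eq_card, ← Nat.card_eq_fintype_card]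
  rfl

theorem tangentConeHilbertSeries_arslan (k : Type*) [Field k] {m : ℕ} (hm : 0 < m) :
    tangentConeHilbertSeries k (semigroupPowerSeries k (semigroupOf (arslanGen m))) *
        (1 - PowerSeries.X) =
      1 + ∑ j ∈ Finset.Icc 1 (m - 1),
          PowerSeries.C (2 * (j : ℤ) + 1) * PowerSeries.X ^ j +
        PowerSeries.C (m : ℤ) * PowerSeries.X ^ m := by
  ext n
  rw [mul_sub, mul_one, map_sub, map_add, map_add, map_sum]
  simp only [coeff_C_mul, coeff_X_pow, mul_ite, mul_one, mul_zero,
    Finset.sum_ite_eq, Finset.mem_Icc]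
  rcases n with _ | n
  · simp [tangentConeHilbertSeries, tangentConeComponent_arslan_finrank k hm,
      arslanLayer_ncard_of_lt hm, hm.ne]
  · simp only [coeff_succ_mul_X, tangentConeHilbertSeries, coeff_mk,
      tangentConeComponent_arslan_finrank k hm, coeff_one]
    -- The differences are `(n+2)² - (n+1)² = 2(n+1) + 1`, then `m(m+1) - m² = m`, then `0`.
    rcases lt_trichotomy (n + 1) m with h | h | h
    · rw [arslanLayer_ncard_of_lt h, arslanLayer_ncard_of_lt (by omega), if_neg (by omega),
        if_pos (by omega), if_neg (by omega)]
      push_cast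
      ring
    · rw [arslanLayer_ncard_of_le hm h.ge, arslanLayer_ncard_of_lt (by omega), if_neg (by omega),
        if_neg (by omega), if_pos h, ← h]
      push_cast
      ring
    · rw [arslanLayer_ncard_of_le hm h.le, arslanLayer_ncard_of_le hm (by omega),
        if_neg (by omega), if_neg (by omega), if_neg (by omega)]
      ring

end Arslan

theorem mainTheorem6 (k : Type*) [Field k] (m : ℕ) (hm : 2 ≤ m) :
    -- the components of the tangent cone are finite-dimensional, so that its Hilbert series exists
    (∀ n : ℕ, Module.Finite k
      (TangentConeComponent (semigroupPowerSeries k (semigroupOf (arslanGen m))) n)) ∧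
    -- the Hilbert series
    tangentConeHilbertSeries k (semigroupPowerSeries k (semigroupOf (arslanGen m))) *
        (1 - PowerSeries.X) =
      1 + ∑ j ∈ Finset.Icc 1 (m - 1),
          PowerSeries.C (2 * (j : ℤ) + 1) * PowerSeries.X ^ j +
        PowerSeries.C (m : ℤ) * PowerSeries.X ^ m ∧
    -- its coefficients count the elements of given order of the Apéry set
    (∀ j < m, {w ∈ aperySet (semigroupOf (arslanGen m)) (m * (m + 1)) |
        factorizationOrder (arslanGen m) w = j}.ncard = 2 * j + 1) ∧
    {w ∈ aperySet (semigroupOf (arslanGen m)) (m * (m + 1)) |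
        factorizationOrder (arslanGen m) w = m}.ncard = m ∧
    (∀ w ∈ aperySet (semigroupOf (arslanGen m)) (m * (m + 1)),
        factorizationOrder (arslanGen m) w ≤ m) := by

  have hm0 : 0 < m := by omega
  refine ⟨tangentConeComponent_arslan_finite k hm0, tangentConeHilbertSeries_arslan k hm0, ?_, ?_,
    fun w => factorizationOrder_le_of_mem_apery hm0⟩
  · rintro (_ | j) hj
    · exact apery_order_zero_ncard hm0
    · have h := apery_order_succ_ncard hm0 j
      rw [arslanLayer_ncard_of_lt hj, arslanLayer_ncard_of_lt (by omega)] at h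
      linarith
  · obtain ⟨j, rfl⟩ := Nat.exists_eq_add_of_le' (by omega : 1 ≤ m)
    have h := apery_order_succ_ncard hm0 j
    rw [arslanLayer_ncard_of_le hm0 le_rfl, arslanLayer_ncard_of_lt (by omega)] at h
    linarith
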